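/- Let $\mathbb N=\{1,2,\dots\}$. Let $a=(a_j)_{j\in\mathbb N}$ be a non-decreasing sequence of positive numbers with $a_j\to\infty$, let $b=(b_j)_{j\in\mathbb N}$ be a sequence of positive numbers, let $0<C_0\le 1\le C_1<\infty$ and $\alpha,\beta\in(0,1)$. Put $$\mathcal E_a=\Big\{\theta\in l^2(\mathbb N):\sum_j a_j^2\theta_j^2\le 1\Big\},\quad \Theta_a(r)=\{\theta\in\mathcal E_a:\|\theta\|\ge r\},\quad \mathcal B(b)=\{\nu\in\mathbb R^{\mathbb N}: C_0|b_j|\le|\nu_j|\le C_1|b_j|\ \text{for all } j\}.$$ For $\varepsilon,\sigma\ge 0$, $\theta\in l^2(\mathbb N)$ and $\bar b\in\mathbb R^{\mathbb N}$ let $\mathbb P^{\varepsilon,\sigma}_{\theta,\bar b}$ be the law of $(Y,X)=(Y_j,X_j)_{j\in\mathbb N}$, where $$Y_j=\bar b_j\theta_j+\varepsilon\,\xi_j,\qquad X_j=\bar b_j+\sigma\,\eta_j,$$ with $\xi,\eta$ independent sequences of independent standard Gaussian variables. The null hypothesis is $\theta=\theta_0$, where the benchmark $\theta_0\in\mathcal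 E_a\setminus\{0\}$ is known to the statistician. Thus a testing procedure $\Psi$ consists of a measurable function $\Psi_{\theta_0}(Y,X)$ for each $\theta_0$, giving the probability of rejecting the null hypothesis; it is non-randomized if its values lie in $\{0,1\}$ and randomized if they lie in $[0,1]$. For a set $T\subseteq\mathcal E_a\setminus\{0\}$ of benchmarks and a set $B$ of sequences, $\Psi$ is an $\alpha$-level test if $\mathbb E^{\varepsilon,\sigma}_{\theta_0,\bar b}\Psi_{\theta_0}\le\alpha$ for all $\theta_0\in T$ and $\bar b\in B$. Its separation radius is the infimum of the $r>0$ such that $\mathbb E^{\varepsilon,\sigma}_{\theta,\bar b}(1-\Psi_{\theta_0})\le\beta$ for all $\theta_0\in T$, all $\theta$ with $\theta-\theta_0\in\Theta_a(r)$ and all $\bar b\in B$. The minimax separation radius is the infimum of the separation radii over all $\alpha$-level tests. For $\varepsilon,\sigma>0$ let - $\tilde r_{\varepsilon,\sigma}(T)$ be the minimax separation radius with noise levels $\varepsilon,\sigma$ and $B=\mathcal B(b)$, over either the randomized or the non-randomized tests; - $\tilde r_{0,\sigma}(T)$ be the one with noise levels $0,\sigma$ and $B=\mathcal B(b)$, over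 the randomized tests; - $\tilde r_{\varepsilon,0}(T)$ be the one with noise levels $\varepsilon,0$ and $B=\{b\}$ (that is, $b$ is known), over the randomized tests. Write $\tilde r_{\varepsilon,\sigma}$ for $\tilde r_{\varepsilon,\sigma}(\mathcal E_a\setminus\{0\})$. **Theorem 4.** Let $\varepsilon>0$ and $\sigma>0$. (1) For every $T\subseteq\mathcal E_a\setminus\{0\}$ (in particular for one given benchmark, $T=\{\theta_0\}$, and for all of them together, $T=\mathcal E_a\setminus\{0\}$), $$\tilde r_{\varepsilon,\sigma}(T)\ \ge\ \tilde r_{0,\sigma}(T)\vee\tilde r_{\varepsilon,0}(T).$$ (2) Suppose that $\alpha+\beta<1$. Put $$C_{\alpha,\beta}=\ln(1+4(1-\alpha-\beta)^2),\qquad c_{\alpha,\beta}=\big(2\ln(1+4(1-\alpha-\beta)^2)\big)^{1/2},$$ $$G_D=\frac1{\sigma\sqrt{2\pi}}\int_{C_0b_D}^{C_1b_D}e^{-(t-b_D)^2/(2\sigma^2)}\,dt,$$ $$S=\Big\{D\in\mathbb N:\ C_{\alpha,\beta}\,\sigma\, b_D^{-1}\le 2,\ \ G_D\ge\big(1+4(1-\alpha-\beta)^2\big)^{-1/2}\Big\},\qquad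 M_2=\sup S .$$ Then, with the convention $\sup\emptyset=0$, $$\tilde r_{\varepsilon,\sigma}^2\ \ge\ \Big\{\frac{C_{\alpha,\beta}^2}{16}\,\sigma^2\,\sup_{D\in S}\big[b_D^{-2}a_D^{-2}\big]\Big\}\ \vee\ \Big\{\sup_{D\in\mathbb N}\Big[c_{\alpha,\beta}\,\varepsilon^2\sqrt{\textstyle\sum_{j=1}^D b_j^{-4}}\ \wedge\ a_D^{-2}\Big]\Big\}.$$ If $b$ is non-increasing, the same holds with the supremum over $D\in S$ replaced by the supremum over $1\le D\le M_2$. -/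

import Mathlib

open MeasureTheory ProbabilityTheory Set Filter
open scoped ENNReal

noncomputable section

namespace GSM

/-- The space `l²(ℕ)` of square-summable real sequences, indices starting at `1`. -/
abbrev L2 : Type := lp (fun _ : ℕ+ => ℝ) 2

/-- The observation space of the pair `(Y, X)` of real sequences. -/
abbrev Obs : Type := (ℕ+ → ℝ) × (ℕ+ → ℝ)

/-- The law of a sequence of independent standard Gaussian variables. -/
def stdNoise : Measure (ℕ+ → ℝ) := Measure.infinitePi fun _ => gaussianReal 0 1

/-- The joint law `P_{θ,b}` of `(Y, X)`, where `Y_j = b_j θ_j + ε ξ_j`, `X_j = b_j + σ η_j`, and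
`ξ`, `η` are independent standard Gaussian sequences. The values `ε = 0` and `σ = 0` are allowed:
the corresponding sequence is then observed without noise. -/
def law (ε σ : ℝ) (θ : L2) (b : ℕ+ → ℝ) : Measure Obs :=
  (stdNoise.prod stdNoise).map fun z =>
    ((fun j => b j * θ j + ε * z.1 j), (fun j => b j + σ * z.2 j))

/-- The ellipsoid `E_a = {θ ∈ l² : ∑ a_j² θ_j² ≤ 1}`. -/
def ellipsoid (a : ℕ+ → ℝ) : Set L2 :=
  {θ | Summable (fun j => a j ^ 2 * θ j ^ 2) ∧ ∑' j, a j ^ 2 * θ j ^ 2 ≤ 1}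

/-- `Θ_a(r)`: the ellipsoid with the ball of radius `r` removed. -/
def alternatives (a : ℕ+ → ℝ) (r : ℝ) : Set L2 := {θ | θ ∈ ellipsoid a ∧ r ≤ ‖θ‖}

/-- The benchmark signals of goodness-of-fit testing: the nonzero elements of the ellipsoid. -/
def benchmarks (a : ℕ+ → ℝ) : Set L2 := {θ₀ | θ₀ ∈ ellipsoid a ∧ θ₀ ≠ 0}

/-- `B(b)`: the sequences comparable to `b` with constants `C₀` and `C₁`. -/
def nearby (C₀ C₁ : ℝ) (b : ℕ+ → ℝ) : Set (ℕ+ → ℝ) :=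
  {ν | ∀ j, C₀ * |b j| ≤ |ν j| ∧ |ν j| ≤ C₁ * |b j|}

/-- A testing procedure: for each (known) benchmark `θ₀`, a measurable function `Ψ θ₀` of the
observation, whose value is the probability of rejecting `θ = θ₀`. The set of allowed values is
`V`: `V = {0, 1}` for non-randomized tests, `V = [0, 1]` for randomized tests. -/
structure IsTest (V : Set ℝ) (Ψ : L2 → Obs → ℝ) : Prop where
  measurable : ∀ θ₀, Measurable (Ψ θ₀)
  mem : ∀ θ₀ z, Ψ θ₀ z ∈ V

/-- First kind error probability, the benchmark ranging over `T` and the unknown sequence of the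
model over `B`. -/
def firstKind (T : Set L2) (B : Set (ℕ+ → ℝ)) (ε σ : ℝ) (Ψ : L2 → Obs → ℝ) : ℝ≥0∞ :=
  ⨆ θ₀ ∈ T, ⨆ b ∈ B, ∫⁻ z, ENNReal.ofReal (Ψ θ₀ z) ∂(law ε σ θ₀ b)

/-- Maximal second kind error probability at radius `r`, over `θ₀ ∈ T`, `θ - θ₀ ∈ Θ_a(r)` and
`b ∈ B`. -/
def secondKind (T : Set L2) (B : Set (ℕ+ → ℝ)) (a : ℕ+ → ℝ) (ε σ r : ℝ)
    (Ψ : L2 → Obs → ℝ) : ℝ≥0∞ :=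
  ⨆ θ₀ ∈ T, ⨆ θ : L2, ⨆ _ : θ - θ₀ ∈ alternatives a r, ⨆ b ∈ B,
    ∫⁻ z, ENNReal.ofReal (1 - Ψ θ₀ z) ∂(law ε σ θ b)

/-- The separation radius of a testing procedure. -/
def sepRadius (T : Set L2) (B : Set (ℕ+ → ℝ)) (a : ℕ+ → ℝ) (β ε σ : ℝ)
    (Ψ : L2 → Obs → ℝ) : ℝ≥0∞ :=
  ⨅ r : ℝ, ⨅ _ : 0 < r ∧ secondKind T B a ε σ r Ψ ≤ ENNReal.ofReal β, ENNReal.ofReal r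

/-- The minimax separation radius over the `α`-level tests with values in `V`. -/
def minimaxRadius (V : Set ℝ) (T : Set L2) (B : Set (ℕ+ → ℝ)) (a : ℕ+ → ℝ)
    (α β ε σ : ℝ) : ℝ≥0∞ :=
  ⨅ Ψ : L2 → Obs → ℝ, ⨅ _ : IsTest V Ψ ∧ firstKind T B ε σ Ψ ≤ ENNReal.ofReal α,
    sepRadius T B a β ε σ Ψ

/-- `C_{α,β} = ln (1 + 4 (1 - α - β)²)`. -/
def bigC (α β : ℝ) : ℝ := Real.log (1 + 4 * (1 - α - β) ^ 2)

/-- `c_{α,β} = (2 ln (1 + 4 (1 - α - β)²)) ^ (1/2)`. -/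
def smallC (α β : ℝ) : ℝ := Real.sqrt (2 * Real.log (1 + 4 * (1 - α - β) ^ 2))

/-- `G_D(C₀, C₁)`, the mass that the Gaussian law with mean `b_D` and variance `σ²` gives to
`[C₀ b_D, C₁ b_D]`. -/
def gaussMass (C₀ C₁ σ : ℝ) (b : ℕ+ → ℝ) (D : ℕ+) : ℝ :=
  1 / (σ * Real.sqrt (2 * Real.pi)) *
    ∫ t in (C₀ * b D)..(C₁ * b D), Real.exp (-(1 / (2 * σ ^ 2)) * (t - b D) ^ 2)

/-- The indices whose supremum is the bandwidth `M₂`. -/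
def admissible (C₀ C₁ α β σ : ℝ) (b : ℕ+ → ℝ) : Set ℕ+ :=
  {D | bigC α β * σ * (b D)⁻¹ ≤ 2 ∧
    1 / Real.sqrt (1 + 4 * (1 - α - β) ^ 2) ≤ gaussMass C₀ C₁ σ b D}

/-- The bandwidth `M₂`; it is `0` if no index is admissible and may be infinite. -/
def bandwidth (C₀ C₁ α β σ : ℝ) (b : ℕ+ → ℝ) : ℕ∞ :=
  ⨆ D ∈ admissible C₀ C₁ α β σ b, ((D : ℕ) : ℕ∞)

/-- The term `(C_{α,β}² / 16) σ² b_D⁻² a_D⁻²`. -/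
def sigmaTerm (a b : ℕ+ → ℝ) (α β σ : ℝ) (D : ℕ+) : ℝ≥0∞ :=
  ENNReal.ofReal (bigC α β ^ 2 / 16 * σ ^ 2 * ((b D ^ 2)⁻¹ * (a D ^ 2)⁻¹))

/-- The term `c_{α,β} ε² (∑_{j ≤ D} b_j⁻⁴) ^ (1/2) ∧ a_D⁻²`. -/
def epsTerm (a b : ℕ+ → ℝ) (α β ε : ℝ) (D : ℕ+) : ℝ≥0∞ :=
  ENNReal.ofReal (min
    (smallC α β * ε ^ 2 * Real.sqrt (∑ j ∈ Finset.Icc 1 D, (b j ^ 4)⁻¹)) ((a D ^ 2)⁻¹))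

end GSM

end

/-!
Adding independent Gaussian noise to the sequence that is observed without noise turns the laws of
either extreme model into those of the full model. Averaging a test over the added noise therefore
keeps both error probabilities, and the extreme models are at least as easy as the full one.

The two extreme models are bounded below by Le Cam's method: translating Gaussian white noise by
`h` changes its law by chi-square divergence `exp (∑ h_j²) - 1`. When `b` is known, the alternative
is `θ₀` perturbed by independent random signs in the coordinates `j ≤ D`. When `Y` is observed
without noise, two pairs `(θ, b)` with the same products `b_j θ_j` differ only in the law of `X`;
they take `θ` on the `D`-th axis of the ellipsoid and differ in `b_D` by a shift of order `σ`.
-/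

namespace GSM

section ProductMeasures

theorem indicator_pi_prod_eq_prod_indicator {ι R : Type*} {X : ι → Type*} [CommMonoidWithZero R]
    {g : (i : ι) → X i → R} {s u : Finset ι} (hsu : s ⊆ u) (hs : ∀ i ∉ s, g i = 1)
    (t : (i : ι) → Set (X i)) (x : (i : ι) → X i) :
    ((u : Set ι).pi t).indicator (fun x => ∏ i ∈ s, g i (x i)) x =
      ∏ i ∈ u, (t i).indicator (g i) (x i) := by
  by_cases hx : x ∈ (u : Set ι).pi t
  · rw [indicator_of_mem hx, Finset.prod_subset hsu fun i _ hi => by rw [hs i hi, Pi.one_apply]]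
    exact Finset.prod_congr rfl fun i hi => (indicator_of_mem (hx i hi) _).symm
  · obtain ⟨i, hi, hxi⟩ : ∃ i ∈ u, x i ∉ t i := by simpa [Set.mem_pi] using hx
    rw [indicator_of_notMem hx, Finset.prod_eq_zero hi (indicator_of_notMem hxi _)]

variable {ι : Type*} {X : ι → Type*} [∀ i, MeasurableSpace (X i)] {μ ν : (i : ι) → Measure (X i)}
  [∀ i, IsProbabilityMeasure (μ i)] {g : (i : ι) → X i → ℝ≥0∞}

theorem lintegral_infinitePi_prod (s : Finset ι) (hg : ∀ i, Measurable (g i)) :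
    ∫⁻ x, ∏ i ∈ s, g i (x i) ∂(Measure.infinitePi μ) = ∏ i ∈ s, ∫⁻ x, g i x ∂(μ i) := by
  rw [lintegral_prod_eq_prod_lintegral_of_indepFun s _ (iIndepFun_infinitePi hg)
    fun i => (hg i).comp (measurable_pi_apply i)]
  exact Finset.prod_congr rfl fun i _ =>
    (measurePreserving_eval_infinitePi μ i).lintegral_comp (hg i)

theorem infinitePi_withDensity_prod [∀ i, IsProbabilityMeasure (ν i)]
    (hg : ∀ i, Measurable (g i)) (hν : ∀ i, (μ i).withDensity (g i) = ν i) {s : Finset ι}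
    (hs : ∀ i ∉ s, g i = 1) :
    (Measure.infinitePi μ).withDensity (fun x => ∏ i ∈ s, g i (x i)) = Measure.infinitePi ν := by
  classical
  refine Measure.eq_infinitePi _ fun u t ht => ?_
  set t' : (i : ι) → Set (X i) := fun i => if i ∈ u then t i else univ with ht'
  have ht'_meas : ∀ i, MeasurableSet (t' i) := fun i => by
    by_cases hi : i ∈ u <;> simp [ht', hi, ht i]
  have hpi : (u : Set ι).pi t = ((s ∪ u : Finset ι) : Set ι).pi t' := by
    ext x
    simp only [Set.mem_pi, Finset.mem_coe, Finset.mem_union, ht']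
    exact ⟨fun h i _ => by by_cases hi : i ∈ u <;> simp [hi, h],
      fun h i hi => by simpa [hi] using h i (Or.inr hi)⟩
  have hmeas : MeasurableSet (((s ∪ u : Finset ι) : Set ι).pi t') :=
    .pi (Finset.countable_toSet _) fun i _ => ht'_meas i
  calc (Measure.infinitePi μ).withDensity (fun x => ∏ i ∈ s, g i (x i)) ((u : Set ι).pi t)
      = ∫⁻ x, ∏ i ∈ s ∪ u, (t' i).indicator (g i) (x i) ∂(Measure.infinitePi μ) := by
        rw [hpi, withDensity_apply _ hmeas, ← lintegral_indicator hmeas]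
        exact lintegral_congr
          (indicator_pi_prod_eq_prod_indicator Finset.subset_union_left hs t')
    _ = ∏ i ∈ s ∪ u, ν i (t' i) := by
        rw [lintegral_infinitePi_prod _ fun i => (hg i).indicator (ht'_meas i)]
        exact Finset.prod_congr rfl fun i _ => by
          rw [lintegral_indicator (ht'_meas i), ← hν, withDensity_apply _ (ht'_meas i)]
    _ = ∏ i ∈ u, ν i (t i) := by
        rw [← Finset.prod_subset Finset.subset_union_right fun i _ hi => by simp [ht', hi]]
        exact Finset.prod_congr rfl fun i hi => by simp [ht', hi]

end ProductMeasures

section ChiSquareMethod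

variable {Ω : Type*} [MeasurableSpace Ω] {μ : Measure Ω}

theorem integrable_of_mem_Icc [IsFiniteMeasure μ] {f : Ω → ℝ} (hf : Measurable f)
    (hf01 : ∀ x, f x ∈ Icc (0 : ℝ) 1) : Integrable f μ :=
  .of_mem_Icc 0 1 hf.aemeasurable (.of_forall hf01)

theorem integrable_mul_one_sub {L f : Ω → ℝ} (hL : Integrable L μ) (hf : Measurable f)
    (hf01 : ∀ x, f x ∈ Icc (0 : ℝ) 1) : Integrable (fun x => L x * (1 - f x)) μ :=
  hL.mul_bdd (c := 1) (by fun_prop) (.of_forall fun x => by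
    rw [Real.norm_eq_abs, abs_le]; constructor <;> linarith [(hf01 x).1, (hf01 x).2])

variable [IsProbabilityMeasure μ]

theorem integral_abs_sub_integral_le_sqrt_variance {L : Ω → ℝ} (hL : MemLp L 2 μ) :
    ∫ x, |L x - μ[L]| ∂μ ≤ √(Var[L; μ]) := by
  have hdev : MemLp (fun x => |L x - μ[L]|) 2 μ := (hL.sub (memLp_const _)).abs
  refine Real.le_sqrt_of_sq_le ?_
  have hvar := variance_nonneg (fun x => |L x - μ[L]|) μ
  rw [variance_eq_sub hdev, sub_nonneg] at hvar
  rw [variance_eq_integral hL.aemeasurable]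
  simpa only [Pi.pow_apply, sq_abs] using hvar

theorem one_sub_half_sqrt_variance_le {L f : Ω → ℝ} (hL : MemLp L 2 μ) (hL1 : ∫ x, L x ∂μ = 1)
    (hf : Measurable f) (hf01 : ∀ x, f x ∈ Icc (0 : ℝ) 1) :
    1 - √(Var[L; μ]) / 2 ≤ ∫ x, f x ∂μ + ∫ x, L x * (1 - f x) ∂μ := by
  have hLi : Integrable L μ := hL.integrable one_le_two
  have hfi : Integrable f μ := integrable_of_mem_Icc hf hf01
  have hLf := integrable_mul_one_sub hLi hf hf01
  have hpointwise : ∀ x, (1 + L x) / 2 - |L x - 1| / 2 ≤ f x + L x * (1 - f x) := fun x => by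
    obtain ⟨h0, h1⟩ := hf01 x
    rcases abs_cases (L x - 1) with ⟨h, _⟩ | ⟨h, _⟩ <;> rw [h] <;> nlinarith
  calc 1 - √(Var[L; μ]) / 2 ≤ 1 - (∫ x, |L x - 1| ∂μ) / 2 := by
        have := integral_abs_sub_integral_le_sqrt_variance hL
        rw [hL1] at this
        gcongr
    _ = ∫ x, ((1 + L x) / 2 - |L x - 1| / 2) ∂μ := by
        rw [integral_sub (by fun_prop) (by fun_prop), integral_div, integral_div,
          integral_add (by fun_prop) (by fun_prop), hL1]
        simp
    _ ≤ ∫ x, (f x + L x * (1 - f x)) ∂μ :=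
        integral_mono (by fun_prop) (hfi.add hLf) hpointwise
    _ = ∫ x, f x ∂μ + ∫ x, L x * (1 - f x) ∂μ := integral_add hfi hLf

theorem variance_average {κ : Type*} {I : Finset κ} (hI : I.Nonempty) {L : κ → Ω → ℝ}
    (hL : ∀ i, MemLp (L i) 2 μ) (hL1 : ∀ i, ∫ x, L i x ∂μ = 1) :
    Var[fun x => (I.card : ℝ)⁻¹ * ∑ i ∈ I, L i x; μ] =
      (∑ i ∈ I, ∑ k ∈ I, ∫ x, L i x * L k x ∂μ) / (I.card : ℝ) ^ 2 - 1 := by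
  have hcard : (I.card : ℝ) ≠ 0 := by exact_mod_cast hI.card_ne_zero
  rw [variance_const_mul, variance_fun_sum' fun i _ => hL i]
  simp only [covariance_eq_sub (hL _) (hL _), hL1, Pi.mul_apply, mul_one, Finset.sum_sub_distrib,
    Finset.sum_const, nsmul_eq_mul]
  field_simp

/-- The chi-square form of Le Cam's method: no test separates `μ` from every law with density `L i`
unless the uniform mixture of these laws is far from `μ` in chi-square divergence. -/
theorem exists_le_integral_add_integral_mul {κ : Type*} {I : Finset κ} (hI : I.Nonempty)
    {L : κ → Ω → ℝ} (hL : ∀ i, MemLp (L i) 2 μ) (hL1 : ∀ i, ∫ x, L i x ∂μ = 1) {f : Ω → ℝ}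
    (hf : Measurable f) (hf01 : ∀ x, f x ∈ Icc (0 : ℝ) 1) :
    ∃ i ∈ I, 1 - √((∑ i ∈ I, ∑ k ∈ I, ∫ x, L i x * L k x ∂μ) / (I.card : ℝ) ^ 2 - 1) / 2 ≤
      ∫ x, f x ∂μ + ∫ x, L i x * (1 - f x) ∂μ := by
  have hcard : (I.card : ℝ) ≠ 0 := by exact_mod_cast hI.card_ne_zero
  have hLi : ∀ i, Integrable (L i) μ := fun i => (hL i).integrable one_le_two
  have hLf := fun i => integrable_mul_one_sub (hLi i) hf hf01
  have hmean : ∫ x, (I.card : ℝ)⁻¹ * ∑ i ∈ I, L i x ∂μ = 1 := by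
    rw [integral_const_mul, integral_finsetSum _ fun i _ => hLi i]
    simp [hL1, hcard]
  have hmixture := one_sub_half_sqrt_variance_le
    ((memLp_finsetSum I fun i _ => hL i).const_mul (I.card : ℝ)⁻¹) hmean hf hf01
  rw [variance_average hI hL hL1] at hmixture
  simp only [mul_assoc, Finset.sum_mul, integral_const_mul] at hmixture
  rw [integral_finsetSum _ fun i _ => hLf i] at hmixture
  refine Finset.exists_le_of_sum_le hI ?_
  rw [Finset.sum_const, nsmul_eq_mul, Finset.sum_add_distrib, Finset.sum_const, nsmul_eq_mul]
  calc _ ≤ (I.card : ℝ) * _ := mul_le_mul_of_nonneg_left hmixture (by positivity)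
    _ = _ := by field_simp

end ChiSquareMethod

section GaussianTranslates

variable {ι : Type*}

/-- The law of a family of independent standard Gaussian variables; `stdNoise` is the case
`ι = ℕ+`. -/
noncomputable abbrev gaussianNoise (ι : Type*) : Measure (ι → ℝ) :=
  Measure.infinitePi fun _ => gaussianReal 0 1

/-- The Cameron–Martin density: the likelihood ratio at `x` between the Gaussian noise translated
by the restriction of `h` to `s` and the Gaussian noise. -/
noncomputable def translationDensity (s : Finset ι) (h x : ι → ℝ) : ℝ :=
  Real.exp (∑ j ∈ s, (h j * x j - h j ^ 2 / 2))

theorem translationDensity_pos (s : Finset ι) (h x : ι → ℝ) : 0 < translationDensity s h x :=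
  Real.exp_pos _

@[fun_prop]
theorem measurable_translationDensity (s : Finset ι) (h : ι → ℝ) :
    Measurable (translationDensity s h) := by
  unfold translationDensity
  fun_prop

theorem translationDensity_mul (s : Finset ι) (h k x : ι → ℝ) :
    translationDensity s h x * translationDensity s k x =
      Real.exp (∑ j ∈ s, h j * k j) * translationDensity s (h + k) x := by
  simp only [translationDensity, ← Real.exp_add, ← Finset.sum_add_distrib, Pi.add_apply]
  congr 1
  exact Finset.sum_congr rfl fun j _ => by ring

theorem gaussianReal_withDensity_exp (h : ℝ) :
    (gaussianReal 0 1).withDensity (fun x => ENNReal.ofReal (Real.exp (h * x - h ^ 2 / 2))) =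
      gaussianReal h 1 := by
  rw [gaussianReal_of_var_ne_zero _ one_ne_zero, gaussianReal_of_var_ne_zero _ one_ne_zero,
    ← withDensity_mul _ (by fun_prop) (by fun_prop)]
  congr 1
  ext x
  simp only [Pi.mul_apply, gaussianPDF, gaussianPDFReal]
  rw [← ENNReal.ofReal_mul (by positivity), mul_assoc, ← Real.exp_add]
  congr 3
  rw [NNReal.coe_one]
  ring

theorem gaussianNoise_map_add (h : ι → ℝ) :
    (gaussianNoise ι).map (· + h) = Measure.infinitePi fun j => gaussianReal (h j) 1 := by
  have hmap := Measure.infinitePi_map_pi (μ := fun _ : ι => gaussianReal 0 1)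
    (f := fun j x => x + h j) fun j => by fun_prop
  simp only [gaussianReal_map_add_const, zero_add] at hmap
  exact hmap

theorem gaussianNoise_withDensity_translationDensity (s : Finset ι) (h : ι → ℝ) :
    (gaussianNoise ι).withDensity (fun x => ENNReal.ofReal (translationDensity s h x)) =
      (gaussianNoise ι).map (· + (s : Set ι).indicator h) := by
  set k : ι → ℝ := (s : Set ι).indicator h
  rw [gaussianNoise_map_add, ← infinitePi_withDensity_prod (s := s) (fun j => by fun_prop)
    (fun j => gaussianReal_withDensity_exp (k j)) fun j hj => by ext x; simp [k, hj]]
  congr 1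
  ext x
  rw [translationDensity, Real.exp_sum,
    ENNReal.ofReal_prod_of_nonneg fun _ _ => (Real.exp_pos _).le]
  exact Finset.prod_congr rfl fun j hj => by simp [k, hj]

theorem integral_add_indicator_gaussianNoise (s : Finset ι) (h : ι → ℝ) (f : (ι → ℝ) → ℝ) :
    ∫ x, f (x + (s : Set ι).indicator h) ∂(gaussianNoise ι) =
      ∫ x, translationDensity s h x * f x ∂(gaussianNoise ι) := by
  have hmap := integral_map_equiv (μ := gaussianNoise ι)
    (MeasurableEquiv.addRight ((s : Set ι).indicator h)) f
  simp only [MeasurableEquiv.coe_addRight] at hmap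
  rw [← hmap, ← gaussianNoise_withDensity_translationDensity,
    integral_withDensity_eq_integral_toReal_smul (by fun_prop) (by simp)]
  simp only [ENNReal.toReal_ofReal (translationDensity_pos s h _).le, smul_eq_mul]

theorem integral_translationDensity (s : Finset ι) (h : ι → ℝ) :
    ∫ x, translationDensity s h x ∂(gaussianNoise ι) = 1 := by
  simpa using (integral_add_indicator_gaussianNoise s h fun _ => 1).symm

theorem integrable_translationDensity (s : Finset ι) (h : ι → ℝ) :
    Integrable (translationDensity s h) (gaussianNoise ι) :=
  integrable_of_integral_eq_one (integral_translationDensity s h)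

theorem memLp_two_translationDensity (s : Finset ι) (h : ι → ℝ) :
    MemLp (translationDensity s h) 2 (gaussianNoise ι) := by
  rw [memLp_two_iff_integrable_sq (by fun_prop)]
  simp only [sq (translationDensity s h _), translationDensity_mul]
  exact (integrable_translationDensity s (h + h)).const_mul _

theorem integral_translationDensity_mul (s : Finset ι) (h k : ι → ℝ) :
    ∫ x, translationDensity s h x * translationDensity s k x ∂(gaussianNoise ι) =
      Real.exp (∑ j ∈ s, h j * k j) := by
  simp only [translationDensity_mul, integral_const_mul, integral_translationDensity, mul_one]

theorem exists_lt_integral_gaussianNoise_add {κ : Type*} {I : Finset κ} (hI : I.Nonempty)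
    (s : Finset ι) (h : κ → ι → ℝ) {δ : ℝ} (hδ : 0 < δ)
    (hχ : (∑ i ∈ I, ∑ k ∈ I, Real.exp (∑ j ∈ s, h i j * h k j)) / (I.card : ℝ) ^ 2 <
      1 + 4 * δ ^ 2)
    {f : (ι → ℝ) → ℝ} (hf : Measurable f) (hf01 : ∀ x, f x ∈ Icc (0 : ℝ) 1) :
    ∃ i ∈ I, 1 - δ < ∫ x, f x ∂(gaussianNoise ι) +
      ∫ x, (1 - f (x + (s : Set ι).indicator (h i))) ∂(gaussianNoise ι) := by
  obtain ⟨i, hi, hle⟩ := exists_le_integral_add_integral_mul hI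
    (fun i => memLp_two_translationDensity s (h i)) (fun i => integral_translationDensity s (h i))
    hf hf01
  simp only [integral_translationDensity_mul] at hle
  rw [← integral_add_indicator_gaussianNoise s (h i) (fun x => 1 - f x)] at hle
  have hsqrt : √((∑ i ∈ I, ∑ k ∈ I, Real.exp (∑ j ∈ s, h i j * h k j)) / (I.card : ℝ) ^ 2 - 1) <
      2 * δ := by
    rw [Real.sqrt_lt' (by positivity)]
    linarith
  exact ⟨i, hi, by linarith⟩

end GaussianTranslates

section Signs

variable {ι : Type*} [DecidableEq ι]

/-- The vector of signs with `+1` on `t` and `-1` elsewhere; `t` ranging over the subsets of `s`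
gives the sign vectors on `s`. -/
noncomputable def signVec (t : Finset ι) (j : ι) : ℝ := if j ∈ t then 1 else -1

theorem signVec_sq (t : Finset ι) (j : ι) : signVec t j ^ 2 = 1 := by
  unfold signVec
  split_ifs <;> norm_num

theorem sum_powerset_exp_sum_signVec (s u : Finset ι) (c : ι → ℝ) :
    ∑ t ∈ s.powerset, Real.exp (∑ j ∈ s, c j * (signVec u j * signVec t j)) =
      (s.powerset.card : ℝ) * ∏ j ∈ s, Real.cosh (c j) := by
  have hcosh : ∀ j, Real.exp (c j * signVec u j) + Real.exp (-(c j * signVec u j)) =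
      2 * Real.cosh (c j) := fun j => by
    rw [Real.cosh_eq]
    unfold signVec
    split_ifs <;> simp only [mul_one, mul_neg, neg_neg] <;> ring
  have hterm : ∀ t ∈ s.powerset, Real.exp (∑ j ∈ s, c j * (signVec u j * signVec t j)) =
      (∏ j ∈ t, Real.exp (c j * signVec u j)) * ∏ j ∈ s \ t, Real.exp (-(c j * signVec u j)) := by
    intro t ht
    rw [← Finset.sum_sdiff (Finset.mem_powerset.1 ht), Real.exp_add, Real.exp_sum, Real.exp_sum,
      mul_comm]
    congr 1
    · exact Finset.prod_congr rfl fun j hj => by simp [signVec, hj]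
    · exact Finset.prod_congr rfl fun j hj => by simp [signVec, (Finset.mem_sdiff.1 hj).2]
  rw [Finset.sum_congr rfl hterm, ← Finset.prod_add]
  simp only [hcosh, Finset.prod_mul_distrib, Finset.prod_const, Finset.card_powerset]
  push_cast
  rfl

theorem average_exp_sum_signVec_le (s : Finset ι) (c : ι → ℝ) :
    (∑ u ∈ s.powerset, ∑ t ∈ s.powerset,
      Real.exp (∑ j ∈ s, c j * (signVec u j * signVec t j))) / (s.powerset.card : ℝ) ^ 2 ≤
      Real.exp (∑ j ∈ s, c j ^ 2 / 2) := by
  have hcard : (s.powerset.card : ℝ) ≠ 0 := by simp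
  simp only [sum_powerset_exp_sum_signVec, Finset.sum_const, nsmul_eq_mul]
  rw [← mul_assoc, ← sq, mul_div_cancel_left₀ _ (pow_ne_zero 2 hcard), Real.exp_sum]
  exact Finset.prod_le_prod (fun j _ => (Real.cosh_pos _).le) fun j _ =>
    Real.cosh_le_exp_half_sq _

end Signs

section ExtremeModels

instance : IsProbabilityMeasure stdNoise :=
  inferInstanceAs (IsProbabilityMeasure (gaussianNoise ℕ+))

instance (ε σ : ℝ) (θ : L2) (b : ℕ+ → ℝ) : IsProbabilityMeasure (law ε σ θ b) :=
  Measure.isProbabilityMeasure_map (by fun_prop)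

theorem law_zero_right (ε : ℝ) (θ : L2) (b : ℕ+ → ℝ) :
    law ε 0 θ b = stdNoise.map fun x => ((fun j => b j * θ j + ε * x j), b) := by
  have hfst := (measurePreserving_fst (μ := stdNoise) (ν := stdNoise)).map_eq
  rw [← hfst, Measure.map_map (by fun_prop) (by fun_prop)]
  simp [law, Function.comp_def]

theorem law_zero_left (σ : ℝ) (θ : L2) (b : ℕ+ → ℝ) :
    law 0 σ θ b = stdNoise.map fun x => ((fun j => b j * θ j), (fun j => b j + σ * x j)) := by
  have hsnd := (measurePreserving_snd (μ := stdNoise) (ν := stdNoise)).map_eq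
  rw [← hsnd, Measure.map_map (by fun_prop) (by fun_prop)]
  simp [law, Function.comp_def]

theorem integral_law_zero_right (ε : ℝ) (θ : L2) (b : ℕ+ → ℝ) {f : Obs → ℝ} (hf : Measurable f) :
    ∫ z, f z ∂(law ε 0 θ b) = ∫ x, f ((fun j => b j * θ j + ε * x j), b) ∂stdNoise := by
  rw [law_zero_right, integral_map ?_ hf.aestronglyMeasurable]
  exact Measurable.aemeasurable (by fun_prop)

theorem integral_law_zero_left (σ : ℝ) (θ : L2) (b : ℕ+ → ℝ) {f : Obs → ℝ} (hf : Measurable f) :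
    ∫ z, f z ∂(law 0 σ θ b) =
      ∫ x, f ((fun j => b j * θ j), (fun j => b j + σ * x j)) ∂stdNoise := by
  rw [law_zero_left, integral_map ?_ hf.aestronglyMeasurable]
  exact Measurable.aemeasurable (by fun_prop)

end ExtremeModels

section Garbling

theorem comp_map_id_prod_const {Ω Ω' Ω'' : Type*} [MeasurableSpace Ω] [MeasurableSpace Ω']
    [MeasurableSpace Ω''] (μ : Measure Ω) [SFinite μ] (ν : Measure Ω') [SFinite ν]
    {F : Ω × Ω' → Ω''} (hF : Measurable F) :
    (Kernel.id ×ₖ Kernel.const Ω ν).map F ∘ₘ μ = (μ.prod ν).map F := by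
  rw [← Measure.map_comp _ _ hF, ← Measure.compProd_eq_comp_prod, Measure.compProd_const]

/-- The randomization adding independent noise of level `ε` to `Y`. -/
noncomputable def addNoiseFst (ε : ℝ) : Kernel Obs Obs :=
  (Kernel.id ×ₖ Kernel.const Obs stdNoise).map fun p => ((fun j => p.1.1 j + ε * p.2 j), p.1.2)

/-- The randomization adding independent noise of level `σ` to `X`. -/
noncomputable def addNoiseSnd (σ : ℝ) : Kernel Obs Obs :=
  (Kernel.id ×ₖ Kernel.const Obs stdNoise).map fun p => (p.1.1, fun j => p.1.2 j + σ * p.2 j)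

instance (ε : ℝ) : IsMarkovKernel (addNoiseFst ε) :=
  Kernel.IsMarkovKernel.map _ (by fun_prop)

instance (σ : ℝ) : IsMarkovKernel (addNoiseSnd σ) :=
  Kernel.IsMarkovKernel.map _ (by fun_prop)

theorem addNoiseFst_comp_law (ε σ : ℝ) (θ : L2) (b : ℕ+ → ℝ) :
    addNoiseFst ε ∘ₘ law 0 σ θ b = law ε σ θ b := by
  rw [addNoiseFst, comp_map_id_prod_const _ _ (by fun_prop), law_zero_left]
  nth_rw 2 [← Measure.map_id (μ := stdNoise)]
  rw [Measure.map_prod_map _ _ (by fun_prop) measurable_id,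
    Measure.map_map (by fun_prop) (by fun_prop)]
  conv_rhs => rw [law, ← Measure.prod_swap, Measure.map_map (by fun_prop) (by fun_prop)]
  rfl

theorem addNoiseSnd_comp_law (ε σ : ℝ) (θ : L2) (b : ℕ+ → ℝ) :
    addNoiseSnd σ ∘ₘ law ε 0 θ b = law ε σ θ b := by
  rw [addNoiseSnd, comp_map_id_prod_const _ _ (by fun_prop), law_zero_right]
  nth_rw 2 [← Measure.map_id (μ := stdNoise)]
  rw [Measure.map_prod_map _ _ (by fun_prop) measurable_id,
    Measure.map_map (by fun_prop) (by fun_prop), law]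
  rfl

theorem lintegral_ofReal_integral_kernel {Ω Ω' : Type*} [MeasurableSpace Ω] [MeasurableSpace Ω']
    (κ : Kernel Ω Ω') [IsFiniteKernel κ] (μ : Measure Ω) {f : Ω' → ℝ} (hf : Measurable f)
    (hf01 : ∀ w, f w ∈ Icc (0 : ℝ) 1) :
    ∫⁻ z, ENNReal.ofReal (∫ w, f w ∂(κ z)) ∂μ = ∫⁻ w, ENNReal.ofReal (f w) ∂(κ ∘ₘ μ) := by
  rw [Measure.lintegral_bind κ.aemeasurable hf.ennreal_ofReal.aemeasurable]
  exact lintegral_congr fun z => ofReal_integral_eq_lintegral_ofReal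
    (integrable_of_mem_Icc hf hf01) (.of_forall fun w => (hf01 w).1)

/-- The test obtained by running `Ψ` on a randomization `κ` of the observation. -/
noncomputable def garble (κ : Kernel Obs Obs) (Ψ : L2 → Obs → ℝ) (θ₀ : L2) (z : Obs) : ℝ :=
  ∫ w, Ψ θ₀ w ∂(κ z)

theorem subset_Icc_of_eq_pair_or_eq_Icc {V : Set ℝ} (hV : V = {0, 1} ∨ V = Icc 0 1) :
    V ⊆ Icc 0 1 := by
  rcases hV with rfl | rfl
  · simp [Set.insert_subset_iff]
  · exact Subset.rfl

theorem IsTest.mono {V W : Set ℝ} (hVW : V ⊆ W) {Ψ : L2 → Obs → ℝ} (hΨ : IsTest V Ψ) :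
    IsTest W Ψ :=
  ⟨hΨ.measurable, fun θ₀ z => hVW (hΨ.mem θ₀ z)⟩

theorem IsTest.integrable {Ψ : L2 → Obs → ℝ} (hΨ : IsTest (Icc 0 1) Ψ) (μ : Measure Obs)
    [IsFiniteMeasure μ] (θ₀ : L2) : Integrable (Ψ θ₀) μ :=
  integrable_of_mem_Icc (hΨ.measurable θ₀) (hΨ.mem θ₀)

variable {κ : Kernel Obs Obs} [IsMarkovKernel κ] {Ψ : L2 → Obs → ℝ} {T : Set L2}
  {B B' : Set (ℕ+ → ℝ)} {ε σ ε' σ' : ℝ}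

theorem IsTest.garble (hΨ : IsTest (Icc 0 1) Ψ) : IsTest (Icc 0 1) (garble κ Ψ) where
  measurable θ₀ := (hΨ.measurable θ₀).stronglyMeasurable.integral_kernel.measurable
  mem θ₀ z := by
    refine ⟨integral_nonneg fun w => (hΨ.mem θ₀ w).1, ?_⟩
    simpa [GSM.garble] using integral_mono (hΨ.integrable (κ z) θ₀) (integrable_const 1)
      fun w => (hΨ.mem θ₀ w).2

theorem firstKind_garble_le (hΨ : IsTest (Icc 0 1) Ψ) (hB : B' ⊆ B)
    (hκ : ∀ θ b, κ ∘ₘ law ε' σ' θ b = law ε σ θ b) :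
    firstKind T B' ε' σ' (garble κ Ψ) ≤ firstKind T B ε σ Ψ := by
  simp only [firstKind, garble,
    lintegral_ofReal_integral_kernel κ _ (hΨ.measurable _) (hΨ.mem _), hκ]
  exact iSup₂_mono fun θ₀ _ => biSup_mono hB

theorem secondKind_garble_le (hΨ : IsTest (Icc 0 1) Ψ) (hB : B' ⊆ B)
    (hκ : ∀ θ b, κ ∘ₘ law ε' σ' θ b = law ε σ θ b) (a : ℕ+ → ℝ) (r : ℝ) :
    secondKind T B' a ε' σ' r (garble κ Ψ) ≤ secondKind T B a ε σ r Ψ := by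
  have hcompl : ∀ θ₀ z, 1 - garble κ Ψ θ₀ z = ∫ w, (1 - Ψ θ₀ w) ∂(κ z) := fun θ₀ z => by
    rw [integral_sub (integrable_const _) (hΨ.integrable _ θ₀)]
    simp [garble]
  simp only [secondKind, hcompl, lintegral_ofReal_integral_kernel κ _
    ((hΨ.measurable _).const_sub 1) fun w => Set.Icc.one_sub_mem (hΨ.mem _ w), hκ]
  exact iSup₂_mono fun θ₀ _ => iSup₂_mono fun θ _ => biSup_mono hB

theorem minimaxRadius_le_of_comp_law {V : Set ℝ} (hV : V ⊆ Icc 0 1) (T : Set L2) (hB : B' ⊆ B)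
    (a : ℕ+ → ℝ) (α β : ℝ) (hκ : ∀ θ b, κ ∘ₘ law ε' σ' θ b = law ε σ θ b) :
    minimaxRadius (Icc 0 1) T B' a α β ε' σ' ≤ minimaxRadius V T B a α β ε σ := by
  refine le_iInf₂ fun Ψ ⟨hΨV, hΨα⟩ => ?_
  have hΨ := hΨV.mono hV
  refine iInf₂_le_of_le (garble κ Ψ) ⟨hΨ.garble, (firstKind_garble_le hΨ hB hκ).trans hΨα⟩ ?_
  exact le_iInf₂ fun r ⟨hr, hβ⟩ =>
    iInf₂_le_of_le r ⟨hr, (secondKind_garble_le hΨ hB hκ a r).trans hβ⟩ le_rfl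

theorem minimaxRadius_zero_left_le {V : Set ℝ} (hV : V ⊆ Icc 0 1) (T : Set L2)
    (B : Set (ℕ+ → ℝ)) (a : ℕ+ → ℝ) (α β ε σ : ℝ) :
    minimaxRadius (Icc 0 1) T B a α β 0 σ ≤ minimaxRadius V T B a α β ε σ :=
  minimaxRadius_le_of_comp_law hV T Subset.rfl a α β (addNoiseFst_comp_law ε σ)

theorem minimaxRadius_zero_right_le {V : Set ℝ} (hV : V ⊆ Icc 0 1) (T : Set L2) (hB : B' ⊆ B)
    (a : ℕ+ → ℝ) (α β ε σ : ℝ) :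
    minimaxRadius (Icc 0 1) T B' a α β ε 0 ≤ minimaxRadius V T B a α β ε σ :=
  minimaxRadius_le_of_comp_law hV T hB a α β (addNoiseSnd_comp_law ε σ)

theorem mem_nearby_self {C₀ C₁ : ℝ} (hC₀ : C₀ ≤ 1) (hC₁ : 1 ≤ C₁) (b : ℕ+ → ℝ) :
    b ∈ nearby C₀ C₁ b := fun _ =>
  ⟨mul_le_of_le_one_left (abs_nonneg _) hC₀, le_mul_of_one_le_left (abs_nonneg _) hC₁⟩

theorem minimaxRadius_extreme_sup_le {V : Set ℝ} (hV : V ⊆ Icc 0 1) (T : Set L2) {C₀ C₁ : ℝ}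
    (hC₀ : C₀ ≤ 1) (hC₁ : 1 ≤ C₁) (a b : ℕ+ → ℝ) (α β ε σ : ℝ) :
    minimaxRadius (Icc 0 1) T (nearby C₀ C₁ b) a α β 0 σ ⊔
        minimaxRadius (Icc 0 1) T {b} a α β ε 0 ≤
      minimaxRadius V T (nearby C₀ C₁ b) a α β ε σ :=
  sup_le (minimaxRadius_zero_left_le hV T _ a α β ε σ) (minimaxRadius_zero_right_le hV T
    (singleton_subset_iff.2 (mem_nearby_self hC₀ hC₁ b)) a α β ε σ)

end Garbling

section TwoHypotheses

variable {Ψ : L2 → Obs → ℝ} {T : Set L2} {B : Set (ℕ+ → ℝ)} {a : ℕ+ → ℝ} {θ₀ θ : L2}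
  {b : ℕ+ → ℝ} {α β ε σ r : ℝ}

theorem integral_le_of_firstKind_le (hΨ : IsTest (Icc 0 1) Ψ) (hα : 0 ≤ α)
    (h : firstKind T B ε σ Ψ ≤ ENNReal.ofReal α) (hθ₀ : θ₀ ∈ T) (hb : b ∈ B) :
    ∫ z, Ψ θ₀ z ∂(law ε σ θ₀ b) ≤ α := by
  rw [← ENNReal.ofReal_le_ofReal_iff hα, ofReal_integral_eq_lintegral_ofReal
    (hΨ.integrable _ θ₀) (.of_forall fun z => (hΨ.mem θ₀ z).1)]
  refine le_trans ?_ h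
  exact le_iSup₂_of_le θ₀ hθ₀ (le_iSup₂_of_le b hb le_rfl)

theorem integral_le_of_secondKind_le (hΨ : IsTest (Icc 0 1) Ψ) (hβ : 0 ≤ β)
    (h : secondKind T B a ε σ r Ψ ≤ ENNReal.ofReal β) (hθ₀ : θ₀ ∈ T)
    (hθ : θ - θ₀ ∈ alternatives a r) (hb : b ∈ B) :
    ∫ z, (1 - Ψ θ₀ z) ∂(law ε σ θ b) ≤ β := by
  rw [← ENNReal.ofReal_le_ofReal_iff hβ, ofReal_integral_eq_lintegral_ofReal
    (by have := hΨ.integrable (law ε σ θ b) θ₀; fun_prop)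
    (.of_forall fun z => sub_nonneg.2 (hΨ.mem θ₀ z).2)]
  refine le_trans ?_ h
  exact le_iSup₂_of_le θ₀ hθ₀ (le_iSup₂_of_le θ hθ (le_iSup₂_of_le b hb le_rfl))

-- The pair of hypotheses may depend on the test `Φ`: Le Cam's method finds it by averaging.
theorem ofReal_le_minimaxRadius_sq {R : ℝ} (hα : 0 ≤ α) (hβ : 0 ≤ β) (hθ₀ : θ₀ ∈ T)
    (h : ∀ r, 0 < r → r ^ 2 < R → ∀ Φ : Obs → ℝ, Measurable Φ → (∀ z, Φ z ∈ Icc (0 : ℝ) 1) →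
      ∃ b₀ ∈ B, ∃ b₁ ∈ B, ∃ θ, θ - θ₀ ∈ alternatives a r ∧
        α + β < ∫ z, Φ z ∂(law ε σ θ₀ b₀) + ∫ z, (1 - Φ z) ∂(law ε σ θ b₁)) :
    ENNReal.ofReal R ≤ minimaxRadius (Icc 0 1) T B a α β ε σ ^ 2 := by
  have hsqrt : ENNReal.ofReal (√R) ≤ minimaxRadius (Icc 0 1) T B a α β ε σ := by
    refine le_iInf₂ fun Ψ ⟨hΨ, hΨα⟩ => le_iInf₂ fun r ⟨hr, hΨβ⟩ => ENNReal.ofReal_le_ofReal ?_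
    by_contra! hlt
    obtain ⟨b₀, hb₀, b₁, hb₁, θ, hθ, hsum⟩ := h r hr ((Real.lt_sqrt hr.le).1 hlt) (Ψ θ₀)
      (hΨ.measurable θ₀) (hΨ.mem θ₀)
    linarith [integral_le_of_firstKind_le hΨ hα hΨα hθ₀ hb₀,
      integral_le_of_secondKind_le hΨ hβ hΨβ hθ₀ hθ hb₁]
  calc ENNReal.ofReal R ≤ ENNReal.ofReal (√R ^ 2) :=
        ENNReal.ofReal_le_ofReal ((le_max_left R 0).trans_eq Real.sq_sqrt'.symm)
    _ = ENNReal.ofReal (√R) ^ 2 := ENNReal.ofReal_pow (Real.sqrt_nonneg R) 2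
    _ ≤ minimaxRadius (Icc 0 1) T B a α β ε σ ^ 2 := by gcongr

end TwoHypotheses

section Signals

/-- The signal with coordinates `v j` for `j ∈ s` and `0` elsewhere. -/
noncomputable def finSignal (s : Finset ℕ+) (v : ℕ+ → ℝ) : L2 :=
  ⟨(s : Set ℕ+).indicator v, memℓp_gen <| summable_of_ne_finset_zero (s := s) fun j hj => by
    simp [hj]⟩

/-- The endpoint of the `D`-th semiaxis of the ellipsoid. -/
noncomputable def semiaxis (a : ℕ+ → ℝ) (D : ℕ+) : L2 := finSignal {D} a⁻¹

variable {a v : ℕ+ → ℝ} {s : Finset ℕ+} {r : ℝ}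

theorem finSignal_apply (s : Finset ℕ+) (v : ℕ+ → ℝ) (j : ℕ+) :
    finSignal s v j = (s : Set ℕ+).indicator v j := rfl

theorem norm_finSignal_sq (s : Finset ℕ+) (v : ℕ+ → ℝ) :
    ‖finSignal s v‖ ^ 2 = ∑ j ∈ s, v j ^ 2 := by
  have hnorm := lp.norm_rpow_eq_tsum (p := 2) (by simp) (finSignal s v)
  simp only [ENNReal.toReal_ofNat, Real.rpow_two] at hnorm
  rw [hnorm, tsum_eq_sum (s := s) fun j hj => by simp [finSignal_apply, hj]]
  exact Finset.sum_congr rfl fun j hj => by simp [finSignal_apply, hj]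

theorem finSignal_mem_ellipsoid (h : ∑ j ∈ s, a j ^ 2 * v j ^ 2 ≤ 1) :
    finSignal s v ∈ ellipsoid a := by
  have hzero : ∀ j ∉ s, a j ^ 2 * finSignal s v j ^ 2 = 0 := fun j hj => by
    simp [finSignal_apply, hj]
  refine ⟨summable_of_ne_finset_zero hzero, le_of_eq_of_le ?_ h⟩
  rw [tsum_eq_sum hzero]
  exact Finset.sum_congr rfl fun j hj => by simp [finSignal_apply, hj]

theorem finSignal_mem_alternatives (h : ∑ j ∈ s, a j ^ 2 * v j ^ 2 ≤ 1)
    (hr : r ^ 2 ≤ ∑ j ∈ s, v j ^ 2) : finSignal s v ∈ alternatives a r :=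
  ⟨finSignal_mem_ellipsoid h, le_of_sq_le_sq (by rwa [norm_finSignal_sq]) (norm_nonneg _)⟩

theorem smul_finSignal (q : ℝ) (s : Finset ℕ+) (v : ℕ+ → ℝ) :
    q • finSignal s v = finSignal s (q • v) := by
  ext j
  simp [finSignal_apply, Set.indicator_apply]

theorem smul_semiaxis_mem_alternatives {D : ℕ+} {q : ℝ} (hD : a D ≠ 0) (hq : q ^ 2 ≤ 1)
    (hr : r ^ 2 ≤ q ^ 2 * (a D ^ 2)⁻¹) : q • semiaxis a D ∈ alternatives a r := by
  rw [semiaxis, smul_finSignal]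
  refine finSignal_mem_alternatives ?_ ?_ <;>
    simp only [Finset.sum_singleton, Pi.smul_apply, Pi.inv_apply, smul_eq_mul, mul_pow, inv_pow]
  · rwa [mul_left_comm, mul_inv_cancel₀ (pow_ne_zero 2 hD), mul_one]
  · exact hr

theorem semiaxis_mem_benchmarks {D : ℕ+} (hD : a D ≠ 0) : semiaxis a D ∈ benchmarks a := by
  refine ⟨finSignal_mem_ellipsoid (by simp [hD]), fun h => ?_⟩
  have hnorm : ‖semiaxis a D‖ ^ 2 = ((a D)⁻¹) ^ 2 := by simp [semiaxis, norm_finSignal_sq]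
  rw [h, norm_zero] at hnorm
  exact hD (by simpa using hnorm.symm)

end Signals

section KnownSequence

variable {a b : ℕ+ → ℝ} {α β ε δ r : ℝ} {s : Finset ℕ+}

theorem exists_signVec_lt_integral_law_zero_right (hε : ε ≠ 0) (θ₀ : L2) (v : ℕ+ → ℝ)
    (hδ : 0 < δ) (hv : ∑ j ∈ s, (b j * v j / ε) ^ 4 / 2 < Real.log (1 + 4 * δ ^ 2))
    {Φ : Obs → ℝ} (hΦ : Measurable Φ) (hΦ01 : ∀ z, Φ z ∈ Icc (0 : ℝ) 1) :
    ∃ t : Finset ℕ+, 1 - δ < ∫ z, Φ z ∂(law ε 0 θ₀ b) +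
      ∫ z, (1 - Φ z) ∂(law ε 0 (θ₀ + finSignal s (signVec t * v)) b) := by
  set h : Finset ℕ+ → ℕ+ → ℝ := fun t j => b j * (signVec t j * v j) / ε with hh
  have hχ : (∑ u ∈ s.powerset, ∑ t ∈ s.powerset, Real.exp (∑ j ∈ s, h u j * h t j)) /
      (s.powerset.card : ℝ) ^ 2 < 1 + 4 * δ ^ 2 := by
    have hmul : ∀ u t j, h u j * h t j =
        (b j * v j / ε) ^ 2 * (signVec u j * signVec t j) := fun u t j => by
      simp only [hh]
      ring
    simp only [hmul]
    refine (average_exp_sum_signVec_le s _).trans_lt ?_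
    rw [← Real.lt_log_iff_exp_lt (by positivity)]
    simpa only [← pow_mul] using hv
  obtain ⟨t, -, ht⟩ := exists_lt_integral_gaussianNoise_add (Finset.powerset_nonempty s) s h hδ hχ
    (f := fun x => Φ ((fun j => b j * θ₀ j + ε * x j), b)) (hΦ.comp (by fun_prop))
    fun x => hΦ01 _
  refine ⟨t, ?_⟩
  have htranslate : ∀ x : ℕ+ → ℝ,
      (fun j => b j * (θ₀ + finSignal s (signVec t * v) : L2) j + ε * x j) =
        fun j => b j * θ₀ j + ε * (x + (s : Set ℕ+).indicator (h t)) j := fun x => by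
    ext j
    simp only [lp.coeFn_add, Pi.add_apply, finSignal_apply]
    by_cases hj : j ∈ s
    · simp only [indicator_of_mem (Finset.mem_coe.2 hj), Pi.mul_apply, hh]
      field_simp
      ring
    · simp [hj]
  rw [integral_law_zero_right _ _ _ hΦ, integral_law_zero_right _ _ _ (hΦ.const_sub 1)]
  simpa only [htranslate] using! ht

/-- The signal amplitudes of norm `r` on `s` that make the random signs hardest to detect: among
the vectors of given norm, those proportional to `b_j⁻²` minimize `∑ b_j⁴ v_j⁴`. -/
noncomputable def leastFavorable (b : ℕ+ → ℝ) (s : Finset ℕ+) (r : ℝ) (j : ℕ+) : ℝ :=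
  r / √(∑ i ∈ s, (b i ^ 4)⁻¹) * (b j ^ 2)⁻¹

theorem leastFavorable_sq (b : ℕ+ → ℝ) (s : Finset ℕ+) (r : ℝ) (j : ℕ+) :
    leastFavorable b s r j ^ 2 = r ^ 2 / (∑ i ∈ s, (b i ^ 4)⁻¹) * (b j ^ 4)⁻¹ := by
  rw [leastFavorable, mul_pow, div_pow, Real.sq_sqrt (Finset.sum_nonneg fun i _ => by positivity),
    inv_pow, ← pow_mul]

theorem sum_inv_pow_four_pos (hs : s.Nonempty) (hb : ∀ j, b j ≠ 0) :
    0 < ∑ i ∈ s, (b i ^ 4)⁻¹ :=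
  Finset.sum_pos (fun j _ => by have := hb j; positivity) hs

theorem sum_leastFavorable_sq (hs : s.Nonempty) (hb : ∀ j, b j ≠ 0) (r : ℝ) :
    ∑ j ∈ s, leastFavorable b s r j ^ 2 = r ^ 2 := by
  simp only [leastFavorable_sq, ← Finset.mul_sum]
  exact div_mul_cancel₀ _ (sum_inv_pow_four_pos hs hb).ne'

theorem sum_mul_leastFavorable_pow_four (b : ℕ+ → ℝ) (s : Finset ℕ+) (ε r : ℝ) :
    ∑ j ∈ s, (b j * leastFavorable b s r j / ε) ^ 4 / 2 =
      (r ^ 2) ^ 2 / (2 * ε ^ 4 * ∑ i ∈ s, (b i ^ 4)⁻¹) := by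
  have hterm : ∀ j, (b j * leastFavorable b s r j / ε) ^ 4 / 2 =
      (r ^ 2) ^ 2 / (2 * ε ^ 4 * (∑ i ∈ s, (b i ^ 4)⁻¹) ^ 2) * (b j ^ 4)⁻¹ := fun j => by
    have hpow : leastFavorable b s r j ^ 4 = (leastFavorable b s r j ^ 2) ^ 2 := by ring
    rw [div_pow, mul_pow, hpow, leastFavorable_sq]
    field_simp
  simp only [hterm, ← Finset.mul_sum]
  field_simp

theorem finSignal_signVec_mul_leastFavorable_mem_alternatives {D : ℕ+} (ha_pos : ∀ j, 0 < a j)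
    (ha_mono : Monotone a) (hb : ∀ j, b j ≠ 0) (hr : r ^ 2 ≤ (a D ^ 2)⁻¹) (t : Finset ℕ+) :
    finSignal (Finset.Icc 1 D) (signVec t * leastFavorable b (Finset.Icc 1 D) r) ∈
      alternatives a r := by
  have hs : (Finset.Icc 1 D).Nonempty := Finset.nonempty_Icc.2 one_le
  have haD := ha_pos D
  refine finSignal_mem_alternatives ?_ ?_ <;>
    simp only [Pi.mul_apply, mul_pow, signVec_sq, one_mul]
  · calc ∑ j ∈ Finset.Icc 1 D, a j ^ 2 * leastFavorable b (Finset.Icc 1 D) r j ^ 2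
        ≤ ∑ j ∈ Finset.Icc 1 D, a D ^ 2 * leastFavorable b (Finset.Icc 1 D) r j ^ 2 := by
          gcongr with j hj
          exacts [(ha_pos j).le, ha_mono (Finset.mem_Icc.1 hj).2]
      _ = a D ^ 2 * r ^ 2 := by rw [← Finset.mul_sum, sum_leastFavorable_sq hs hb]
      _ ≤ a D ^ 2 * (a D ^ 2)⁻¹ := by gcongr
      _ = 1 := mul_inv_cancel₀ (by positivity)
  · rw [sum_leastFavorable_sq hs hb]

theorem epsTerm_le_minimaxRadius_sq (ha_pos : ∀ j, 0 < a j) (ha_mono : Monotone a)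
    (hb : ∀ j, b j ≠ 0) (hα : 0 ≤ α) (hβ : 0 ≤ β) (hαβ : α + β < 1) (hε : ε ≠ 0) {T : Set L2}
    (hT : T.Nonempty) (D : ℕ+) :
    epsTerm a b α β ε D ≤ minimaxRadius (Icc 0 1) T {b} a α β ε 0 ^ 2 := by
  obtain ⟨θ₀, hθ₀⟩ := hT
  refine ofReal_le_minimaxRadius_sq hα hβ hθ₀ fun r _ hlt Φ hΦ hΦ01 => ?_
  obtain ⟨hr_eps, hr_a⟩ := lt_min_iff.1 hlt
  have hs : (Finset.Icc 1 D).Nonempty := Finset.nonempty_Icc.2 one_le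
  have hW := sum_inv_pow_four_pos hs hb
  have hlog : 0 ≤ 2 * Real.log (1 + 4 * (1 - α - β) ^ 2) :=
    mul_nonneg zero_le_two (Real.log_nonneg (by nlinarith [sq_nonneg (1 - α - β)]))
  have henergy : ∑ j ∈ Finset.Icc 1 D, (b j * leastFavorable b (Finset.Icc 1 D) r j / ε) ^ 4 / 2 <
      Real.log (1 + 4 * (1 - α - β) ^ 2) := by
    rw [sum_mul_leastFavorable_pow_four, div_lt_iff₀ (by positivity)]
    calc (r ^ 2) ^ 2 < (smallC α β * ε ^ 2 * √(∑ j ∈ Finset.Icc 1 D, (b j ^ 4)⁻¹)) ^ 2 :=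
          pow_lt_pow_left₀ hr_eps (sq_nonneg r) two_ne_zero
      _ = _ := by
          rw [mul_pow, mul_pow, Real.sq_sqrt hW.le, smallC, Real.sq_sqrt hlog]
          ring
  obtain ⟨t, ht⟩ := exists_signVec_lt_integral_law_zero_right hε θ₀ _
    (show 0 < 1 - α - β by linarith) henergy hΦ hΦ01
  refine ⟨b, rfl, b, rfl, _, ?_, by linarith⟩
  rw [add_sub_cancel_left]
  exact finSignal_signVec_mul_leastFavorable_mem_alternatives ha_pos ha_mono hb hr_a.le t

end KnownSequence

section NoiselessImage

variable {a b : ℕ+ → ℝ} {C₀ C₁ α β σ δ q x : ℝ} {D D' : ℕ+} {T : Set L2} {B : Set (ℕ+ → ℝ)}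

theorem lt_integral_law_zero_left {s : Finset ℕ+} {θ₀ θ : L2} {b₀ b₁ : ℕ+ → ℝ} (hσ : σ ≠ 0)
    (hY : ∀ j, b₁ j * θ j = b₀ j * θ₀ j) (hX : ∀ j ∉ s, b₁ j = b₀ j) (hδ : 0 < δ)
    (hdist : ∑ j ∈ s, ((b₁ j - b₀ j) / σ) ^ 2 < Real.log (1 + 4 * δ ^ 2)) {Φ : Obs → ℝ}
    (hΦ : Measurable Φ) (hΦ01 : ∀ z, Φ z ∈ Icc (0 : ℝ) 1) :
    1 - δ < ∫ z, Φ z ∂(law 0 σ θ₀ b₀) + ∫ z, (1 - Φ z) ∂(law 0 σ θ b₁) := by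
  set h : ℕ+ → ℝ := fun j => (b₁ j - b₀ j) / σ with hh
  obtain ⟨-, -, hlt⟩ := exists_lt_integral_gaussianNoise_add (Finset.singleton_nonempty ()) s
    (fun _ => h) hδ
    (by simpa [← sq, hh] using (Real.lt_log_iff_exp_lt (by positivity)).1 hdist)
    (f := fun x => Φ ((fun j => b₀ j * θ₀ j), fun j => b₀ j + σ * x j)) (hΦ.comp (by fun_prop))
    fun x => hΦ01 _
  have htranslate : ∀ x : ℕ+ → ℝ, (fun j => b₁ j + σ * x j) =
      fun j => b₀ j + σ * (x + (s : Set ℕ+).indicator h) j := fun x => by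
    ext j
    by_cases hj : j ∈ s
    · simp only [Pi.add_apply, indicator_of_mem (Finset.mem_coe.2 hj), hh]
      field_simp
      ring
    · simp [hj, hX j hj]
  rw [integral_law_zero_left _ _ _ hΦ, integral_law_zero_left _ _ _ (hΦ.const_sub 1)]
  simpa only [htranslate, hY] using! hlt

theorem update_mul_smul_semiaxis (a b : ℕ+ → ℝ) (D : ℕ+) (x c : ℝ) (j : ℕ+) :
    Function.update b D x j * (c • semiaxis a D : L2) j =
      Function.update b D (x * c) j * semiaxis a D j := by
  rw [semiaxis, smul_finSignal, finSignal_apply, finSignal_apply]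
  by_cases hj : j = D
  · subst hj
    simp [mul_assoc]
  · simp [hj]

-- Stretching `θ_D` and shrinking `b_D` by the same factor `1 + q` leaves the noiseless `Y` alone,
-- so only the shift of `b_D` by `x q` can reveal the alternative.
theorem ofReal_le_minimaxRadius_zero_left_sq (hD : a D ≠ 0) (hα : 0 ≤ α) (hβ : 0 ≤ β)
    (hαβ : α + β < 1) (hσ : σ ≠ 0) (hT : semiaxis a D ∈ T) (hq : q ^ 2 ≤ 1)
    (hx : Function.update b D x ∈ B) (hxq : Function.update b D (x * (1 + q)) ∈ B)
    (hdist : (x * q / σ) ^ 2 < bigC α β) :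
    ENNReal.ofReal (q ^ 2 * (a D ^ 2)⁻¹) ≤ minimaxRadius (Icc 0 1) T B a α β 0 σ ^ 2 := by
  refine ofReal_le_minimaxRadius_sq hα hβ hT fun r _ hlt Φ hΦ hΦ01 =>
    ⟨_, hxq, _, hx, (1 + q) • semiaxis a D, ?_, ?_⟩
  · rw [add_smul, one_smul, add_sub_cancel_left]
    exact smul_semiaxis_mem_alternatives hD hq hlt.le
  · have hsum := lt_integral_law_zero_left (s := {D}) hσ
      (update_mul_smul_semiaxis a b D x (1 + q))
      (fun j hj => by simp [Finset.mem_singleton.not.1 hj]) (show 0 < 1 - α - β by linarith)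
      (by rwa [Finset.sum_singleton, Function.update_self, Function.update_self,
          show (x - x * (1 + q)) / σ = -(x * q / σ) by ring, neg_sq]) hΦ hΦ01
    linarith

theorem bigC_pos (hαβ : α + β < 1) : 0 < bigC α β :=
  Real.log_pos (by nlinarith [sub_pos.2 hαβ])

theorem bigC_le_four (hα : 0 ≤ α) (hβ : 0 ≤ β) (hαβ : α + β < 1) : bigC α β ≤ 4 := by
  have hlog := Real.log_le_sub_one_of_pos (x := 1 + 4 * (1 - α - β) ^ 2) (by positivity)
  unfold bigC
  nlinarith

theorem gaussMass_le (hσ : 0 < σ) (h : C₀ * b D ≤ C₁ * b D) :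
    gaussMass C₀ C₁ σ b D ≤ (C₁ - C₀) * b D / (σ * √(2 * Real.pi)) := by
  rw [gaussMass, one_div_mul_eq_div]
  gcongr
  calc ∫ t in (C₀ * b D)..(C₁ * b D), Real.exp (-(1 / (2 * σ ^ 2)) * (t - b D) ^ 2)
      ≤ ∫ _ in (C₀ * b D)..(C₁ * b D), (1 : ℝ) := by
        refine intervalIntegral.integral_mono_on h
          (Continuous.intervalIntegrable (by fun_prop) _ _) (by simp) fun t _ => ?_
        rw [Real.exp_le_one_iff, neg_mul, neg_nonpos]
        positivity
    _ = (C₁ - C₀) * b D := by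
        rw [intervalIntegral.integral_const, smul_eq_mul, mul_one, sub_mul]

theorem bigC_mul_le_of_mem_admissible (hb : 0 < b D) (hD : D ∈ admissible C₀ C₁ α β σ b) :
    bigC α β * σ ≤ 2 * b D := by
  have hbound := hD.1
  rwa [← div_eq_mul_inv, div_le_iff₀ hb] at hbound

theorem le_length_of_mem_admissible (hb : 0 < b D) (hC : C₀ ≤ C₁) (hσ : 0 < σ) (hα : 0 ≤ α)
    (hβ : 0 ≤ β) (hαβ : α + β < 1) (hD : D ∈ admissible C₀ C₁ α β σ b) :
    σ ≤ (C₁ - C₀) * b D := by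
  have hsqrt : √(1 + 4 * (1 - α - β) ^ 2) ≤ √(2 * Real.pi) :=
    Real.sqrt_le_sqrt (by nlinarith [Real.pi_gt_three])
  have hpos : 0 < √(1 + 4 * (1 - α - β) ^ 2) := Real.sqrt_pos.2 (by positivity)
  have hmass := hD.2.trans (gaussMass_le hσ (by gcongr))
  rw [div_le_div_iff₀ hpos (by positivity), one_mul] at hmass
  refine le_of_mul_le_mul_right ?_ hpos
  calc σ * √(1 + 4 * (1 - α - β) ^ 2) ≤ σ * √(2 * Real.pi) := by gcongr
    _ ≤ (C₁ - C₀) * b D * √(1 + 4 * (1 - α - β) ^ 2) := hmass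

theorem update_mul_mem_nearby {c : ℝ} (hC₀ : 0 ≤ C₀) (hC₀_le : C₀ ≤ 1) (hC₁ : 1 ≤ C₁)
    (hc₀ : C₀ ≤ c) (hc₁ : c ≤ C₁) : Function.update b D (c * b D) ∈ nearby C₀ C₁ b := fun j => by
  by_cases hj : j = D
  · subst hj
    rw [Function.update_self, abs_mul, abs_of_nonneg (hC₀.trans hc₀)]
    exact ⟨by gcongr, by gcongr⟩
  · rw [Function.update_of_ne hj]
    exact mem_nearby_self hC₀_le hC₁ b j

theorem sigmaTerm_le_minimaxRadius_sq (ha : a D ≠ 0) (hb : ∀ j, 0 < b j) (hC₀ : 0 < C₀)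
    (hC₀_le : C₀ ≤ 1) (hC₁ : 1 ≤ C₁) (hα : 0 ≤ α) (hβ : 0 ≤ β) (hαβ : α + β < 1) (hσ : 0 < σ)
    (hT : semiaxis a D ∈ T) (hD' : D' ∈ admissible C₀ C₁ α β σ b) (hD'D : b D' ≤ b D) :
    sigmaTerm a b α β σ D ≤ minimaxRadius (Icc 0 1) T (nearby C₀ C₁ b) a α β 0 σ ^ 2 := by
  have hC : 0 < bigC α β := bigC_pos hαβ
  have hC4 : bigC α β / 4 ≤ 1 := (div_le_one four_pos).2 (bigC_le_four hα hβ hαβ)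
  have hbD : 0 < b D := hb D
  have hC₀C₁ : C₀ ≤ C₁ := hC₀_le.trans hC₁
  have hwidth : bigC α β * σ ≤ 2 * b D :=
    (bigC_mul_le_of_mem_admissible (hb D') hD').trans (by gcongr)
  have hlength : σ ≤ (C₁ - C₀) * b D :=
    (le_length_of_mem_admissible (hb D') hC₀C₁ hσ hα hβ hαβ hD').trans
      (mul_le_mul_of_nonneg_left hD'D (sub_nonneg.2 hC₀C₁))
  obtain ⟨q, hq⟩ : ∃ q, q * b D = bigC α β / 4 * σ := ⟨_, div_mul_cancel₀ _ hbD.ne'⟩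
  have hq0 : 0 ≤ q := nonneg_of_mul_nonneg_left (by rw [hq]; positivity) hbD
  have hq1 : q ≤ 1 := le_of_mul_le_mul_right (by linarith) hbD
  have hstretch : C₀ * (1 + q) ≤ C₁ := by
    have hgap : C₀ * (q * b D) ≤ σ := by
      rw [hq]
      exact (mul_le_of_le_one_left (by positivity) hC₀_le).trans
        (mul_le_of_le_one_left hσ.le hC4)
    refine le_of_mul_le_mul_right ?_ hbD
    linarith
  have hshift : (C₀ * b D * q / σ) ^ 2 < bigC α β := calc
    _ = (C₀ * (bigC α β / 4)) ^ 2 := by rw [mul_assoc, mul_comm (b D), hq]; field_simp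
    _ ≤ (bigC α β / 4) ^ 2 := by gcongr; exact mul_le_of_le_one_left (by positivity) hC₀_le
    _ < bigC α β := by nlinarith
  have hradius : bigC α β ^ 2 / 16 * σ ^ 2 * ((b D ^ 2)⁻¹ * (a D ^ 2)⁻¹) =
      q ^ 2 * (a D ^ 2)⁻¹ := by
    rw [eq_div_of_mul_eq hbD.ne' hq]
    ring
  rw [sigmaTerm, hradius]
  refine ofReal_le_minimaxRadius_zero_left_sq ha hα hβ hαβ hσ.ne' hT (pow_le_one₀ hq0 hq1)
    (update_mul_mem_nearby hC₀.le hC₀_le hC₁ le_rfl hC₀C₁) ?_ hshift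
  rw [mul_right_comm]
  exact update_mul_mem_nearby hC₀.le hC₀_le hC₁ (le_mul_of_one_le_right hC₀.le (by linarith))
    hstretch

theorem exists_mem_admissible_of_le_bandwidth (h : ((D : ℕ) : ℕ∞) ≤ bandwidth C₀ C₁ α β σ b) :
    ∃ D' ∈ admissible C₀ C₁ α β σ b, D ≤ D' := by
  have hlt : (((D : ℕ) - 1 : ℕ) : ℕ∞) < bandwidth C₀ C₁ α β σ b :=
    (Nat.cast_lt.2 (Nat.sub_lt D.pos one_pos)).trans_le h
  obtain ⟨D', hD', hDD'⟩ := lt_biSup_iff.1 hlt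
  exact ⟨D', hD', (PNat.coe_le_coe _ _).1 (Nat.le_of_pred_lt (Nat.cast_lt.1 hDD'))⟩

end NoiselessImage

end GSM

theorem theorem4_general
    (a b : ℕ+ → ℝ) (ha_pos : ∀ j, 0 < a j) (ha_mono : Monotone a) (hb_pos : ∀ j, 0 < b j)
    (C₀ C₁ : ℝ) (hC₀ : 0 < C₀) (hC₀_le : C₀ ≤ 1) (hC₁_ge : 1 ≤ C₁)
    (α β : ℝ) (hα : 0 ≤ α) (hβ : 0 ≤ β) (V : Set ℝ) (hV : V ⊆ Set.Icc 0 1)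
    (ε σ : ℝ) (hε : ε ≠ 0) (hσ : 0 < σ) (T : Set GSM.L2) :
    (GSM.minimaxRadius (Set.Icc 0 1) T (GSM.nearby C₀ C₁ b) a α β 0 σ ⊔
          GSM.minimaxRadius (Set.Icc 0 1) T {b} a α β ε 0
        ≤ GSM.minimaxRadius V T (GSM.nearby C₀ C₁ b) a α β ε σ) ∧
    (α + β < 1 → (∀ D, GSM.semiaxis a D ∈ T) →
      (⨆ D ∈ GSM.admissible C₀ C₁ α β σ b, GSM.sigmaTerm a b α β σ D) ⊔
          (⨆ D : ℕ+, GSM.epsTerm a b α β ε D)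
        ≤ GSM.minimaxRadius V T (GSM.nearby C₀ C₁ b) a α β ε σ ^ 2) ∧
    (α + β < 1 → (∀ D, GSM.semiaxis a D ∈ T) → Antitone b →
      (⨆ D : ℕ+, ⨆ _ : ((D : ℕ) : ℕ∞) ≤ GSM.bandwidth C₀ C₁ α β σ b,
          GSM.sigmaTerm a b α β σ D) ⊔
          (⨆ D : ℕ+, GSM.epsTerm a b α β ε D)
        ≤ GSM.minimaxRadius V T (GSM.nearby C₀ C₁ b) a α β ε σ ^ 2) := by
  have hextreme := GSM.minimaxRadius_extreme_sup_le hV T hC₀_le hC₁_ge a b α β ε σ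
  obtain ⟨hnoiseless, hknown⟩ := sup_le_iff.1 hextreme
  have heps (hαβ : α + β < 1) (hT : ∀ D, GSM.semiaxis a D ∈ T) (D : ℕ+) :=
    (GSM.epsTerm_le_minimaxRadius_sq ha_pos ha_mono (fun j => (hb_pos j).ne') hα hβ hαβ hε
      ⟨_, hT 1⟩ D).trans (pow_le_pow_left' hknown 2)
  have hsigma (hαβ : α + β < 1) (hT : ∀ D, GSM.semiaxis a D ∈ T) {D D' : ℕ+}
      (hD' : D' ∈ GSM.admissible C₀ C₁ α β σ b) (hD'D : b D' ≤ b D) :=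
    (GSM.sigmaTerm_le_minimaxRadius_sq (ha_pos D).ne' hb_pos hC₀ hC₀_le hC₁_ge hα hβ hαβ hσ
      (hT D) hD' hD'D).trans (pow_le_pow_left' hnoiseless 2)
  refine ⟨hextreme, fun hαβ hT => sup_le (iSup₂_le fun D hD => hsigma hαβ hT hD le_rfl)
    (iSup_le (heps hαβ hT)), fun hαβ hT hb_anti => sup_le (iSup₂_le fun D hD => ?_)
    (iSup_le (heps hαβ hT))⟩
  obtain ⟨D', hD', hDD'⟩ := GSM.exists_mem_admissible_of_le_bandwidth hD
  exact hsigma hαβ hT hD' (hb_anti hDD')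

theorem theorem4
    (a b : ℕ+ → ℝ) (ha_pos : ∀ j, 0 < a j) (ha_mono : Monotone a)
    (ha_lim : Filter.Tendsto a Filter.atTop Filter.atTop) (hb_pos : ∀ j, 0 < b j)
    (C₀ C₁ : ℝ) (hC₀ : 0 < C₀) (hC₀_le : C₀ ≤ 1) (hC₁_ge : 1 ≤ C₁)
    (α β : ℝ) (hα : α ∈ Set.Ioo (0 : ℝ) 1) (hβ : β ∈ Set.Ioo (0 : ℝ) 1)
    (V : Set ℝ) (hV : V = {0, 1} ∨ V = Set.Icc 0 1)
    (ε σ : ℝ) (hε : 0 < ε) (hσ : 0 < σ) :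
    -- the comparison with both extreme models, for any set `T` of benchmarks
    -- (one given benchmark, or all of them)
    (∀ T : Set GSM.L2, T ⊆ GSM.benchmarks a →
      GSM.minimaxRadius (Set.Icc 0 1) T (GSM.nearby C₀ C₁ b) a α β 0 σ ⊔
          GSM.minimaxRadius (Set.Icc 0 1) T {b} a α β ε 0
        ≤ GSM.minimaxRadius V T (GSM.nearby C₀ C₁ b) a α β ε σ) ∧
    -- the explicit lower bound
    (α + β < 1 →
      (⨆ D ∈ GSM.admissible C₀ C₁ α β σ b, GSM.sigmaTerm a b α β σ D) ⊔
          (⨆ D : ℕ+, GSM.epsTerm a b α β ε D)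
        ≤ GSM.minimaxRadius V (GSM.benchmarks a) (GSM.nearby C₀ C₁ b) a α β ε σ ^ 2) ∧
    -- the same with `1 ≤ D ≤ M₂`, for a non-increasing sequence `b`
    (α + β < 1 → Antitone b →
      (⨆ D : ℕ+, ⨆ _ : ((D : ℕ) : ℕ∞) ≤ GSM.bandwidth C₀ C₁ α β σ b,
          GSM.sigmaTerm a b α β σ D) ⊔
          (⨆ D : ℕ+, GSM.epsTerm a b α β ε D)
        ≤ GSM.minimaxRadius V (GSM.benchmarks a) (GSM.nearby C₀ C₁ b) a α β ε σ ^ 2) := by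
  have key := theorem4_general a b ha_pos ha_mono hb_pos C₀ C₁ hC₀ hC₀_le hC₁_ge α β hα.1.le hβ.1.le
    V (GSM.subset_Icc_of_eq_pair_or_eq_Icc hV) ε σ hε.ne' hσ
  have hT := fun D => GSM.semiaxis_mem_benchmarks (ha_pos D).ne'
  exact ⟨fun T _ => (key T).1, fun hαβ => (key _).2.1 hαβ hT, fun hαβ => (key _).2.2 hαβ hT⟩
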